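/- All rings are commutative with $1\neq 0$, and subrings contain the identity of the ring. A maximal subring of a ring $A$ is a subring that is maximal with respect to inclusion among the proper subrings of $A$; $A$ is zero-dimensional if its Krull dimension is $0$, and semilocal if it has only finitely many maximal ideals ($A$ need not be noetherian). Let $N(A)$ denote the nilradical of $A$. Let $R\subseteq T$ be an extension of rings with $T=R[\alpha_1,\ldots,\alpha_n]$ for some $\alpha_1,\ldots,\alpha_n\in T$, and assume that $T$ has only finitely many maximal subrings. Then: 1. $R$ is zero-dimensional if and only if $T$ is zero-dimensional. 2. $R$ is semilocal (resp. artinian) if and only if $T$ is semilocal (resp. artinian). Moreover, if $R$ or $T$ is zero-dimensional, semilocal or artinian, then $T$ is a finitely generated $R$-module, and for each prime ideal $P$ of $R$ the ring $R/P$ has only finitely many maximal subrings. Furthermore, if $R$ or $T$ is semilocal or artinian, then $R/N(R)$ has only finitely many maximal subrings up to isomorphism, i.e. its maximal subrings fall into finitely many ring isomorphism classes. -/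

import Mathlib

/-- The set of all maximal subrings of `A`: the subrings that are maximal, with respect to
inclusion, among the proper (unital) subrings of `A`. -/
def RgMax (A : Type*) [CommRing A] : Set (Subring A) :=
  {S | IsCoatom S}

/-- `A` has only finitely many maximal subrings up to (ring) isomorphism: finitely many maximal
subrings represent all isomorphism types of maximal subrings. -/
def FinitelyManyMaximalSubringsUpToIso (A : Type*) [CommRing A] : Prop :=
  ∃ F : Set (Subring A), F.Finite ∧ F ⊆ RgMax A ∧
    ∀ S ∈ RgMax A, ∃ S' ∈ F, Nonempty (S ≃+* S')

/-- The (possibly non-noetherian) commutative ring `A` is semilocal: it has only finitely many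
maximal ideals. -/
def SemilocalRing (A : Type*) [CommRing A] : Prop :=
  {M : Ideal A | M.IsMaximal}.Finite

/-- The commutative ring `A` is zero-dimensional: its Krull dimension is `0`. -/
def ZeroDimensional (A : Type*) [CommRing A] : Prop :=
  ringKrullDim A = 0

open Polynomial

/-! Having finitely many maximal subrings passes to quotients, so each domain `T ⧸ Q` has the
property, and the aim is to show that it is an algebraic extension of a finite prime field.

The engine is `RgMax_infinite_of_isUnit`: if infinitely many pairwise coprime primes of a UFD `D`
inside a domain `B` become units in `B`, each prime `p` yields its own maximal subring, lying over
the integral closure of a localization at `p` and missing `1/p`. A semilocal ring containing `ℤ` or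
`𝔽_p[x]` inverts almost all of its primes, so semilocal subrings of such a `B` with finitely many
maximal subrings are absolutely algebraic. For `B` finitely generated over a field `k` with a
transcendental `x`, either infinitely many irreducibles of `k[x]` are units in `B`, or infinitely
many non-units `z` give maximal subrings over `k + z²B`; hence `B` is algebraic over `k`.

Under any of the conditions on `R` or `T`, all `T ⧸ Q` are therefore absolutely algebraic fields.
Each element of `T` is then a root of some `X ^ p ^ n - X` modulo each prime, which forces `T` to be
integral, hence finite, over `R`; the transfer of dimension, semilocality and the artinian property
follows.

For `R ⧸ P`, a maximal subring of an absolutely algebraic field corresponds to a prime `q` whose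
exponent in the Steinitz number of the field is finite and nonzero. A finite extension raises a
finite exponent by a bounded amount, so these primes for `R ⧸ P` inject into those for `T ⧸ Q`.
Finally, a maximal subring of the reduced ring `R ⧸ nilradical R` either comes from one residue
field or identifies two residue fields, and the latter kind has finitely many isomorphism types. -/

/-! ### Maximal subrings: quotients and existence -/

theorem comap_mem_RgMax {A B : Type*} [CommRing A] [CommRing B] {f : A →+* B}
    (hf : Function.Surjective f) {M : Subring B} (hM : M ∈ RgMax B) : M.comap f ∈ RgMax A := by
  refine ⟨fun h => hM.1 ?_, fun S hS => ?_⟩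
  · rw [eq_top_iff]
    intro b _
    obtain ⟨a, rfl⟩ := hf b
    have : a ∈ M.comap f := h ▸ Subring.mem_top a
    exact this
  · have hle : M < S.map f := by
      obtain ⟨h1, h2⟩ := SetLike.lt_iff_le_and_exists.1 hS
      obtain ⟨x, hxS, hx⟩ := h2
      refine SetLike.lt_iff_le_and_exists.2 ⟨fun b hb => ?_, f x, ⟨x, hxS, rfl⟩, hx⟩
      obtain ⟨a, rfl⟩ := hf b
      exact ⟨a, h1 hb, rfl⟩
    have htop := hM.2 _ hle
    rw [eq_top_iff]
    intro a _
    have : f a ∈ S.map f := htop ▸ Subring.mem_top _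
    obtain ⟨s, hs, hsa⟩ := this
    have : a - s ∈ S := hS.le (show f (a - s) ∈ M by rw [map_sub, hsa, sub_self]; exact M.zero_mem)
    simpa using S.add_mem this hs

theorem RgMax_finite_of_surjective {A B : Type*} [CommRing A] [CommRing B] (f : A →+* B)
    (hf : Function.Surjective f) (h : (RgMax A).Finite) : (RgMax B).Finite :=
  Set.Finite.of_finite_image (h.subset (Set.image_subset_iff.2 fun _ hM => comap_mem_RgMax hf hM))
    fun M _ N _ h => by
      ext b
      obtain ⟨a, rfl⟩ := hf b
      exact SetLike.ext_iff.1 h a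

/-- Zorn applies because `B` is finitely generated over `S`: a member of the chain containing all of
`t` would already be `B`, so the supremum of a chain of proper subrings stays proper. -/
theorem exists_mem_RgMax_ge {B : Type*} [CommRing B] {S : Subring B} {t : Set B} (ht : t.Finite)
    (hgen : Subring.closure (S ∪ t) = ⊤) (hS : S ≠ ⊤) : ∃ M ∈ RgMax B, S ≤ M := by
  obtain ⟨M, hSM, hM⟩ := zorn_le_nonempty₀ {N : Subring B | S ≤ N ∧ N ≠ ⊤} (by
    intro c hc hchain N hN
    have hdir : DirectedOn (· ≤ ·) c := hchain.directedOn
    refine ⟨sSup c, ⟨(hc hN).1.trans (le_sSup hN), fun htop => ?_⟩, fun z hz => le_sSup hz⟩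
    have hsub : ∃ N' ∈ c, t ⊆ N' := by
      have : ∀ x ∈ t, ∃ N' ∈ c, x ∈ N' := fun x _ =>
        (Subring.mem_sSup_of_directedOn ⟨N, hN⟩ hdir).1 (htop ▸ Subring.mem_top x)
      choose! g hg1 hg2 using this
      have : Nonempty c := ⟨⟨N, hN⟩⟩
      have : IsDirectedOrder c := directedOn_iff_isDirectedOrder.1 hdir
      have : Finite t := ht
      obtain ⟨N', hle⟩ := Finite.exists_le fun x : t => (⟨g x, hg1 x x.2⟩ : c)
      exact ⟨N', N'.2, fun x hx => hle ⟨x, hx⟩ (hg2 x hx)⟩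
    obtain ⟨N', hN', htN⟩ := hsub
    refine (hc hN').2 (top_le_iff.1 (hgen ▸ Subring.closure_le.2 (Set.union_subset ?_ htN)))
    exact (hc hN').1) S ⟨le_rfl, hS⟩
  refine ⟨M, ⟨hM.prop.2, fun N hN => ?_⟩, hSM⟩
  by_contra hne
  exact hN.not_ge (hM.le_of_ge ⟨hSM.trans hN.le, hne⟩ hN.le)

/-! ### Primes of a UFD that become units -/

/-- The subring `S` below is the integral closure in `B` of the localization of `E` at `(p)`. It
misses `b = 1/p`, while adjoining `b` to it gives all of `B`. The last clause is what separates the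
subrings belonging to different primes. -/
theorem exists_mem_RgMax_of_prime_of_algebraic {E B : Type*} [CommRing E] [IsDomain E]
    [UniqueFactorizationMonoid E] [CommRing B] [IsDomain B] [Algebra E B]
    (hinj : Function.Injective (algebraMap E B)) [Algebra.IsAlgebraic E B] {p : E} (hp : Prime p)
    {b : B} (hb : b * algebraMap E B p = 1) :
    ∃ M ∈ RgMax B, b ∉ M ∧ ∀ (d : E) (c : B), ¬ p ∣ d → c * algebraMap E B d = 1 → c ∈ M := by
  let S : Subring B :=
    { carrier := {y | ∃ a : E, ¬ p ∣ a ∧ IsIntegral E (a • y)}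
      one_mem' := ⟨1, fun h => hp.not_isUnit (isUnit_of_dvd_one h), by simpa using isIntegral_one⟩
      zero_mem' := ⟨1, fun h => hp.not_isUnit (isUnit_of_dvd_one h), by simpa using isIntegral_zero⟩
      mul_mem' := by
        rintro x y ⟨a, ha, hx⟩ ⟨a', ha', hy⟩
        refine ⟨a * a', fun h => (hp.dvd_or_dvd h).elim ha ha', ?_⟩
        rw [← smul_mul_smul_comm]
        exact hx.mul hy
      add_mem' := by
        rintro x y ⟨a, ha, hx⟩ ⟨a', ha', hy⟩
        refine ⟨a * a', fun h => (hp.dvd_or_dvd h).elim ha ha', ?_⟩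
        have : (a * a') • (x + y) = a' • (a • x) + a • (a' • y) := by
          rw [smul_add, smul_smul, smul_smul, mul_comm a' a]
        rw [this]
        exact (hx.smul a').add (hy.smul a)
      neg_mem' := by
        rintro x ⟨a, ha, hx⟩
        exact ⟨a, ha, by rw [smul_neg]; exact hx.neg⟩ }
  have hbS : ∀ N : Subring B, S ≤ N → b ∈ N → N = ⊤ := by
    intro N hSN hbN
    rw [eq_top_iff]
    intro y _
    obtain ⟨a, ha, hay⟩ := (Algebra.IsAlgebraic.isAlgebraic (R := E) y).exists_integral_multiple
    obtain ⟨a', haa', ha'⟩ :=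
      -- Split the denominator as `a = p ^ k * a'`: the factor `a'` is allowed in `S`, and `p ^ k`
      -- is cancelled by `b ^ k`.
      (FiniteMultiplicity.of_prime_left hp ha).exists_eq_pow_mul_and_not_dvd
    generalize multiplicity p a = k at haa'
    have h1 : p ^ k • y ∈ N := hSN ⟨a', ha', by rwa [smul_smul, mul_comm, ← haa']⟩
    have h2 : y = b ^ k * (p ^ k • y) := by
      rw [Algebra.smul_def, ← mul_assoc, map_pow, ← mul_pow, hb, one_pow, one_mul]
    rw [h2]
    exact N.mul_mem (N.pow_mem hbN k) h1
  have hbnot : b ∉ S := by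
    rintro ⟨a, ha, f, hf, hf0⟩
    -- Rational root argument: `a • b = a / p` is a root of the monic `f`, so `a` is a root of
    -- `f.scaleRoots p`. Modulo `p` this polynomial is a power of `X`, whence `p ∣ a`.
    have h1 : aeval (algebraMap E B a) (f.scaleRoots p) = 0 := by
      have := scaleRoots_aeval_eq_zero (p := f) (r := p) (a := a • b) hf0
      have h2 : algebraMap E B p * a • b = algebraMap E B a := by
        rw [Algebra.smul_def, mul_left_comm, mul_comm _ b, hb, mul_one]
      rwa [h2] at this
    rw [aeval_algebraMap_apply, map_eq_zero_iff _ hinj, coe_aeval_eq_eval] at h1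
    have h3 : eval (Ideal.Quotient.mk (Ideal.span {p}) a)
        ((f.scaleRoots p).map (Ideal.Quotient.mk (Ideal.span {p}))) = 0 := by
      rw [eval_map_apply, h1, map_zero]
    have hnt : Nontrivial (E ⧸ Ideal.span {p}) :=
      Ideal.Quotient.nontrivial_iff.2 (fun h => hp.not_isUnit (Ideal.span_singleton_eq_top.1 h))
    have h4 : Ideal.Quotient.mk (Ideal.span {p}) p = 0 :=
      Ideal.Quotient.eq_zero_iff_mem.2 (Ideal.mem_span_singleton_self p)
    rw [map_scaleRoots _ _ _ (by rw [hf.leadingCoeff, map_one]; exact one_ne_zero), h4,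
      scaleRoots_zero, (hf.map _).leadingCoeff, one_smul, eval_pow, eval_X, ← map_pow,
      Ideal.Quotient.eq_zero_iff_mem, Ideal.mem_span_singleton] at h3
    exact ha (hp.dvd_of_dvd_pow h3)
  obtain ⟨M, hM, hSM⟩ := exists_mem_RgMax_ge (S := S) (Set.finite_singleton b)
    (hbS _ (fun x hx => Subring.subset_closure (Or.inl hx)) (Subring.subset_closure (Or.inr rfl)))
    (fun h => hbnot (h ▸ Subring.mem_top b))
  refine ⟨M, hM, fun h => hM.1 (hbS M hSM h), fun d c hd hc => hSM ⟨d, hd, ?_⟩⟩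
  rw [Algebra.smul_def, mul_comm, hc]
  exact isIntegral_one

/-- A transcendence basis reduces to the algebraic case: the polynomial ring on it is again a UFD,
in which `p` remains prime and divides no new constants. -/
theorem exists_mem_RgMax_of_prime {D B : Type*} [CommRing D] [IsDomain D]
    [UniqueFactorizationMonoid D] [CommRing B] [IsDomain B] [Algebra D B]
    (hinj : Function.Injective (algebraMap D B)) {p : D} (hp : Prime p)
    {b : B} (hb : b * algebraMap D B p = 1) :
    ∃ M ∈ RgMax B, b ∉ M ∧ ∀ (d : D) (c : B), ¬ p ∣ d → c * algebraMap D B d = 1 → c ∈ M := by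
  have : FaithfulSMul D B := (faithfulSMul_iff_algebraMap_injective D B).2 hinj
  obtain ⟨s, hs⟩ := exists_isTranscendenceBasis D B
  let φ : MvPolynomial s D →ₐ[D] B := MvPolynomial.aeval (Subtype.val : s → B)
  let _ : Algebra (MvPolynomial s D) B := φ.toRingHom.toAlgebra
  have hmap : ∀ f, algebraMap (MvPolynomial s D) B f = φ f := fun _ => rfl
  have : IsScalarTower D (MvPolynomial s D) B := IsScalarTower.of_algebraMap_eq fun d => by
    rw [hmap, MvPolynomial.algebraMap_eq, MvPolynomial.algHom_C]
  have hφ : Function.Injective φ := hs.1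
  have halg : Algebra.IsAlgebraic (MvPolynomial s D) B := by
    have := hs.isAlgebraic
    refine Algebra.IsAlgebraic.of_ringHom_of_comp_eq
      (S := Algebra.adjoin D (Set.range (Subtype.val : s → B))) (B := B)
      (φ.codRestrict (Algebra.adjoin D (Set.range Subtype.val)) fun f => ?_).toRingHom
      (RingHom.id B) ?_ Function.injective_id ?_
    · rw [Algebra.adjoin_range_eq_range_aeval]
      exact ⟨f, rfl⟩
    · rintro ⟨y, hy⟩
      rw [Algebra.adjoin_range_eq_range_aeval] at hy
      obtain ⟨f, hf⟩ := hy
      exact ⟨f, Subtype.ext hf⟩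
    · rfl
  obtain ⟨M, hM, hbM, h⟩ := exists_mem_RgMax_of_prime_of_algebraic (E := MvPolynomial s D) hφ
    (p := MvPolynomial.C p) ((MvPolynomial.prime_C_iff _).2 hp) (b := b)
    (by rwa [hmap, MvPolynomial.algHom_C])
  refine ⟨M, hM, hbM, fun d c hd hc => h (MvPolynomial.C d) c (fun hdvd => hd ?_) (by rwa [hmap, MvPolynomial.algHom_C])⟩
  simpa using (MvPolynomial.C_dvd_iff_dvd_coeff p (MvPolynomial.C d)).1 hdvd 0

theorem RgMax_infinite_of_isUnit {D B ι : Type*} [CommRing D] [IsDomain D]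
    [UniqueFactorizationMonoid D] [CommRing B] [IsDomain B] [Algebra D B]
    (hinj : Function.Injective (algebraMap D B)) [Infinite ι] (p : ι → D) (hp : ∀ i, Prime (p i))
    (hcop : Pairwise fun i j => IsCoprime (p i) (p j)) (hu : ∀ i, IsUnit (algebraMap D B (p i))) :
    (RgMax B).Infinite := by
  choose b hb using fun i => (hu i).exists_left_inv
  choose M hM hbM h using fun i => exists_mem_RgMax_of_prime hinj (hp i) (hb i)
  refine Set.infinite_of_injective_forall_mem (f := M) (fun i j hij => ?_) hM
  by_contra hne
  refine hbM i (hij ▸ h j (p i) (b i) (fun hd => (hp j).not_isUnit ?_) (hb i))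
  exact (hcop hne).isUnit_of_dvd' hd dvd_rfl

/-! ### Semilocal subrings are absolutely algebraic -/

/-- A commutative ring of prime characteristic all of whose elements lie in finite fields, i.e. are
fixed by some positive power of the Frobenius endomorphism. -/
def IsAbsolutelyAlgebraic (B : Type*) [CommRing B] : Prop :=
  ∃ p : ℕ, p.Prime ∧ CharP B p ∧ ∀ x : B, ∃ n, 0 < n ∧ x ^ p ^ n = x

theorem IsAbsolutelyAlgebraic.of_injective {A B : Type*} [CommRing A] [CommRing B] (f : A →+* B)
    (hf : Function.Injective f) (h : IsAbsolutelyAlgebraic B) : IsAbsolutelyAlgebraic A := by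
  obtain ⟨p, hp, hc, hx⟩ := h
  refine ⟨p, hp, (f.charP_iff hf p).2 hc, fun x => ?_⟩
  obtain ⟨n, hn, h⟩ := hx (f x)
  exact ⟨n, hn, hf (by rw [map_pow, h])⟩

theorem IsAbsolutelyAlgebraic.isField {B : Type*} [CommRing B] [IsDomain B]
    (h : IsAbsolutelyAlgebraic B) : IsField B := by
  obtain ⟨p, hp, -, hx⟩ := h
  refine ⟨exists_pair_ne B, mul_comm, fun {a} ha => ?_⟩
  obtain ⟨n, hn, h⟩ := hx a
  have h2 : 2 ≤ p ^ n := hp.two_le.trans (Nat.le_self_pow hn.ne' p)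
  refine ⟨a ^ (p ^ n - 2), mul_left_cancel₀ ha ?_⟩
  rw [← pow_succ', ← pow_succ', mul_one]
  rwa [show p ^ n - 2 + 1 + 1 = p ^ n by omega]

theorem exists_pow_pow_eq_self_of_isAlgebraic {p : ℕ} [Fact p.Prime] {R : Type*} [CommRing R]
    [IsDomain R] [Algebra (ZMod p) R] {x : R} (hx : IsAlgebraic (ZMod p) x) :
    ∃ n, 0 < n ∧ x ^ p ^ n = x := by
  have : Module.Finite (ZMod p) (Algebra.adjoin (ZMod p) {x}) :=
    Module.Finite.iff_fg.2 hx.isIntegral.fg_adjoin_singleton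
  have : Finite (Algebra.adjoin (ZMod p) {x}) := Module.finite_of_finite (ZMod p)
  have := Fintype.ofFinite (Algebra.adjoin (ZMod p) {x})
  classical
  let _ : Field (Algebra.adjoin (ZMod p) {x}) := Fintype.fieldOfDomain _
  refine ⟨Module.finrank (ZMod p) (Algebra.adjoin (ZMod p) {x}), Module.finrank_pos, ?_⟩
  have h := FiniteField.pow_card (⟨x, Algebra.self_mem_adjoin_singleton _ x⟩ :
    Algebra.adjoin (ZMod p) {x})
  rw [Module.card_eq_pow_finrank (K := ZMod p), ZMod.card] at h
  exact congrArg Subtype.val h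

theorem infinite_monic_irreducible (k : Type*) [Field k] :
    Infinite {f : k[X] // f.Monic ∧ Irreducible f} := by
  let g : AlgebraicClosure k → {f : k[X] // f.Monic ∧ Irreducible f} := fun a =>
    ⟨minpoly k a, minpoly.monic (Algebra.IsIntegral.isIntegral a),
      minpoly.irreducible (Algebra.IsIntegral.isIntegral a)⟩
  by_contra hfin
  rw [not_infinite_iff_finite] at hfin
  refine Set.infinite_univ (α := AlgebraicClosure k) (Set.Finite.subset
    (Set.finite_iUnion fun f : {f : k[X] // f.Monic ∧ Irreducible f} =>
      (f.1.rootSet_finite (AlgebraicClosure k))) fun a _ => ?_)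
  refine Set.mem_iUnion.2 ⟨g a, ?_⟩
  rw [mem_rootSet]
  exact ⟨(g a).2.2.ne_zero, minpoly.aeval k a⟩

theorem isCoprime_of_monic_irreducible {k : Type*} [Field k] :
    Pairwise fun f g : {f : k[X] // f.Monic ∧ Irreducible f} => IsCoprime f.1 g.1 := by
  intro f g hfg
  refine (f.2.2.coprime_iff_not_dvd).2 fun h => hfg (Subtype.ext ?_)
  exact eq_of_monic_of_associated f.2.1 g.2.1 (f.2.2.associated_of_dvd g.2.2 h)

/-- Each non-unit lies in a maximal ideal, and coprime elements cannot share one. -/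
theorem finite_not_isUnit_of_semilocal {D R ι : Type*} [CommRing D] [CommRing R] [Algebra D R]
    (hR : SemilocalRing R) (p : ι → D) (hcop : Pairwise fun i j => IsCoprime (p i) (p j)) :
    {i | ¬ IsUnit (algebraMap D R (p i))}.Finite := by
  have : Finite {M : Ideal R | M.IsMaximal} := hR
  choose M hM hpM using fun i : {i | ¬ IsUnit (algebraMap D R (p i))} =>
    exists_max_ideal_of_mem_nonunits i.2
  refine Finite.of_injective (fun i => (⟨M i, hM i⟩ : {M : Ideal R | M.IsMaximal})) fun i j hij => ?_
  by_contra hne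
  have hM' : M i = M j := congrArg Subtype.val hij
  obtain ⟨u, v, huv⟩ := (hcop fun h => hne (Subtype.ext h)).map (algebraMap D R)
  exact (hM i).ne_top ((Ideal.eq_top_iff_one _).2 (huv ▸ (M i).add_mem
    ((M i).mul_mem_left _ (hpM i)) ((M i).mul_mem_left _ (hM' ▸ hpM j))))

theorem RgMax_infinite_of_semilocal {D R T ι : Type*} [CommRing D] [IsDomain D]
    [UniqueFactorizationMonoid D] [CommRing R] [CommRing T] [IsDomain T] [Algebra D R]
    [Algebra R T] (hR : SemilocalRing R)
    (hinj : Function.Injective ((algebraMap R T).comp (algebraMap D R))) [Infinite ι] (p : ι → D)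
    (hp : ∀ i, Prime (p i)) (hcop : Pairwise fun i j => IsCoprime (p i) (p j)) :
    (RgMax T).Infinite := by
  let _ : Algebra D T := ((algebraMap R T).comp (algebraMap D R)).toAlgebra
  have := (finite_not_isUnit_of_semilocal hR p hcop).infinite_compl.to_subtype
  refine RgMax_infinite_of_isUnit (D := D) hinj
    (fun i : ↑{i | ¬ IsUnit (algebraMap D R (p i))}ᶜ => p i) (fun i => hp i)
    (fun i j h => hcop fun h' => h (Subtype.ext h')) fun i => ?_
  exact (not_not.1 i.2).map (algebraMap R T)

/-- Otherwise `R` contains `ℤ` or `𝔽_p[x]`, each with infinitely many pairwise coprime primes,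
almost all of them invertible in `R` and hence in `T`. -/
theorem isAbsolutelyAlgebraic_of_semilocal {R T : Type*} [CommRing R] [IsDomain R] [CommRing T]
    [IsDomain T] [Algebra R T] (hinj : Function.Injective (algebraMap R T))
    (hR : SemilocalRing R) (hT : (RgMax T).Finite) : IsAbsolutelyAlgebraic R := by
  obtain ⟨p, hp⟩ := CharP.exists R
  rcases CharP.char_is_prime_or_zero R p with hpr | rfl
  · have : Fact p.Prime := ⟨hpr⟩
    let _ : Algebra (ZMod p) R := ZMod.algebra R p
    refine ⟨p, hpr, hp, fun x => exists_pow_pow_eq_self_of_isAlgebraic ?_⟩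
    by_contra hx
    have := infinite_monic_irreducible (ZMod p)
    let _ : Algebra (ZMod p)[X] R := (aeval x).toRingHom.toAlgebra
    exact RgMax_infinite_of_semilocal (D := (ZMod p)[X]) hR
      (hinj.comp (transcendental_iff_injective.1 hx)) _ (fun f => f.2.2.prime)
      isCoprime_of_monic_irreducible hT
  · have : CharZero R := CharP.charP_to_charZero R
    refine (RgMax_infinite_of_semilocal (D := ℤ) (ι := Nat.Primes) hR
      (hinj.comp (RingHom.injective_int _)) (fun q => ((q : ℕ) : ℤ))
      (fun q => Nat.prime_iff_prime_int.1 q.2) (fun q r h => ?_) hT).elim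
    exact Nat.isCoprime_iff_coprime.2 ((Nat.coprime_primes q.2 r.2).2 fun h' => h (Subtype.ext h'))

/-! ### Finitely generated domains over a field -/

theorem closure_range_union_eq_top {k B : Type*} [CommRing k] [CommRing B] [Algebra k B] {t : Set B}
    (ht : Algebra.adjoin k t = ⊤) {S : Subring B} (hS : (algebraMap k B).range ≤ S) :
    Subring.closure (S ∪ t) = ⊤ := by
  rw [eq_top_iff]
  intro b _
  have hb : b ∈ Algebra.adjoin k t := ht ▸ Algebra.mem_top
  induction hb using Algebra.adjoin_induction with
  | mem x hx => exact Subring.subset_closure (Or.inr hx)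
  | algebraMap r => exact Subring.subset_closure (Or.inl (hS ⟨r, rfl⟩))
  | add x y _ _ hx hy => exact Subring.add_mem _ (hx trivial) (hy trivial)
  | mul x y _ _ hx hy => exact Subring.mul_mem _ (hx trivial) (hy trivial)

/-- The subring `k + z²B` is proper because it omits `z`. The square is needed: `k + zB` may be all
of `B`. -/
theorem exists_mem_RgMax_ideal_le {k B : Type*} [Field k] [CommRing B] [IsDomain B] [Algebra k B]
    [Algebra.FiniteType k B] {z : B} (hz0 : z ≠ 0) (hz : ¬ IsUnit z) :
    ∃ M ∈ RgMax B, ∀ b, b * z ^ 2 ∈ M := by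
  let I : Ideal B := Ideal.span {z ^ 2}
  have hI : Nontrivial (B ⧸ I) := Ideal.Quotient.nontrivial_iff.2 fun h =>
    hz ((isUnit_pow_iff two_ne_zero).1 (Ideal.span_singleton_eq_top.1 h))
  obtain ⟨t, ht⟩ := Algebra.FiniteType.out (R := k) (A := B)
  obtain ⟨M, hM, hSM⟩ := exists_mem_RgMax_ge
    (S := (algebraMap k (B ⧸ I)).range.comap (Ideal.Quotient.mk I)) t.finite_toSet
    (closure_range_union_eq_top ht (by
      rintro _ ⟨c, rfl⟩
      exact ⟨c, rfl⟩)) (fun h => by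
      obtain ⟨c, hc⟩ : z ∈ (algebraMap k (B ⧸ I)).range.comap (Ideal.Quotient.mk I) :=
        h ▸ Subring.mem_top z
      -- A constant congruent to `z` would have square zero, hence vanish; then `z² ∣ z`, making `z`
      -- a unit.
      have hc2 : algebraMap k (B ⧸ I) (c ^ 2) = 0 := by
        rw [map_pow, hc, ← map_pow]
        exact Ideal.Quotient.eq_zero_iff_mem.2 (Ideal.mem_span_singleton_self _)
      have hc0 : c = 0 := eq_zero_of_pow_eq_zero
        ((map_eq_zero_iff _ (algebraMap k (B ⧸ I)).injective).1 hc2)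
      rw [hc0, map_zero, eq_comm, Ideal.Quotient.eq_zero_iff_mem, Ideal.mem_span_singleton] at hc
      obtain ⟨w, hw⟩ := hc
      refine hz (IsUnit.of_mul_eq_one w (mul_left_cancel₀ hz0 ?_))
      rw [mul_one, ← mul_assoc, ← sq, ← hw])
  refine ⟨M, hM, fun b => hSM ⟨0, ?_⟩⟩
  rw [map_zero, eq_comm, Ideal.Quotient.eq_zero_iff_mem]
  exact I.mul_mem_left b (Ideal.mem_span_singleton_self _)

theorem isAlgebraic_of_RgMax_finite {k B : Type*} [Field k] [CommRing B] [IsDomain B] [Algebra k B]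
    [Algebra.FiniteType k B] (hB : (RgMax B).Finite) : Algebra.IsAlgebraic k B := by
  refine ⟨fun x => ?_⟩
  by_contra hx
  have hxi : Function.Injective (aeval (R := k) x) := transcendental_iff_injective.1 hx
  have hinf := infinite_monic_irreducible k
  let U := {f : {f : k[X] // f.Monic ∧ Irreducible f} | IsUnit (aeval x f.1)}
  by_cases hU : U.Finite
  · have := hU.infinite_compl.to_subtype
    choose M hM h using fun f : ↑Uᶜ => exists_mem_RgMax_ideal_le (k := k) (z := aeval x f.1.1)
      ((map_ne_zero_iff _ hxi).2 f.1.2.2.ne_zero) f.2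
    refine Set.infinite_of_injective_forall_mem (f := M) (fun f g hfg => ?_) hM hB
    by_contra hne
    -- If the two subrings agreed, they would contain two comaximal ideals of `B`, hence all of `B`.
    refine (hM f).1 (eq_top_iff.2 fun b _ => ?_)
    obtain ⟨u, v, huv⟩ := ((isCoprime_of_monic_irreducible fun h' =>
      hne (Subtype.ext h')).pow (m := 2) (n := 2)).map (aeval (R := k) x).toRingHom
    have hb : b = b * u * aeval x f.1.1 ^ 2 + b * v * aeval x g.1.1 ^ 2 := by
      simp only [map_pow, AlgHom.toRingHom_eq_coe, RingHom.coe_coe] at huv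
      linear_combination -b * huv
    rw [hb]
    exact (M f).add_mem (h f _) (hfg ▸ h g _)
  · have : Infinite U := Set.infinite_coe_iff.2 hU
    let _ : Algebra k[X] B := (aeval x).toRingHom.toAlgebra
    exact RgMax_infinite_of_isUnit (D := k[X]) hxi (fun f : U => f.1.1) (fun f => f.1.2.2.prime)
      (fun f g h => isCoprime_of_monic_irreducible fun h' => h (Subtype.ext h')) (fun f => f.2) hB

/-! ### Degrees of elements of absolutely algebraic fields -/

/-- The degree over the prime field of an element of a field that is algebraic over it, described
as the length of its Frobenius orbit. -/
noncomputable def frobDeg {K : Type*} [Field K] (p : ℕ) [Fact p.Prime] [CharP K p] (x : K) : ℕ :=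
  Function.minimalPeriod (frobenius K p) x

theorem Nat.Prime.pow_dvd_or_pow_dvd_of_pow_dvd_lcm {q e a b : ℕ} (hq : q.Prime)
    (h : q ^ e ∣ Nat.lcm a b) : q ^ e ∣ a ∨ q ^ e ∣ b := by
  rcases eq_or_ne a 0 with rfl | ha
  · exact Or.inl (dvd_zero _)
  rcases eq_or_ne b 0 with rfl | hb
  · exact Or.inr (dvd_zero _)
  rw [hq.pow_dvd_iff_le_factorization (Nat.lcm_ne_zero ha hb), Nat.factorization_lcm ha hb,
    Finsupp.sup_apply, le_sup_iff] at h
  rwa [hq.pow_dvd_iff_le_factorization ha, hq.pow_dvd_iff_le_factorization hb]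

theorem Nat.Prime.pow_add_dvd_mul {q a b m n : ℕ} (hq : q.Prime) (h : q ^ (a + b) ∣ m * n) :
    q ^ (a + 1) ∣ m ∨ q ^ b ∣ n := by
  rcases eq_or_ne m 0 with rfl | hm
  · exact Or.inl (dvd_zero _)
  rcases eq_or_ne n 0 with rfl | hn
  · exact Or.inr (dvd_zero _)
  rw [hq.pow_dvd_iff_le_factorization (mul_ne_zero hm hn), Nat.factorization_mul hm hn,
    Finsupp.add_apply] at h
  rw [hq.pow_dvd_iff_le_factorization hm, hq.pow_dvd_iff_le_factorization hn]
  omega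

section

variable {K : Type*} [Field K] {p : ℕ} [Fact p.Prime] [CharP K p]

theorem frobDeg_dvd_iff {x : K} {n : ℕ} : frobDeg p x ∣ n ↔ x ^ p ^ n = x := by
  rw [frobDeg, ← Function.isPeriodicPt_iff_minimalPeriod_dvd, Function.IsPeriodicPt,
    Function.IsFixedPt, iterate_frobenius]

theorem pow_frobDeg (x : K) : x ^ p ^ frobDeg p x = x := frobDeg_dvd_iff.1 dvd_rfl

theorem frobDeg_pos (hK : ∀ x : K, ∃ n, 0 < n ∧ x ^ p ^ n = x) (x : K) : 0 < frobDeg p x := by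
  obtain ⟨n, hn, h⟩ := hK x
  exact Nat.pos_of_dvd_of_pos (frobDeg_dvd_iff.2 h) hn

theorem frobDeg_map {L : Type*} [Field L] [CharP L p] (f : K →+* L) (x : K) :
    frobDeg p (f x) = frobDeg p x := by
  refine Nat.dvd_antisymm ?_ ?_ <;> rw [frobDeg_dvd_iff]
  · rw [← map_pow, pow_frobDeg]
  · exact f.injective (by rw [map_pow, pow_frobDeg])

variable (K p) in
/-- The elements of `K` fixed by the `n`-th power of the Frobenius endomorphism. -/
def frobFixed (n : ℕ) : Subring K := (iterateFrobenius K p n).eqLocus (RingHom.id K)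

theorem mem_frobFixed {n : ℕ} {x : K} : x ∈ frobFixed K p n ↔ x ^ p ^ n = x := by
  change iterateFrobenius K p n x = x ↔ _
  rw [iterateFrobenius_def]

theorem frobFixed_finite_and_ncard_le {n : ℕ} (hn : 0 < n) :
    (frobFixed K p n : Set K).Finite ∧ (frobFixed K p n : Set K).ncard ≤ p ^ n := by
  classical
  have hp : 1 < p := (Fact.out : p.Prime).one_lt
  have hne := FiniteField.X_pow_card_pow_sub_X_ne_zero K hn.ne' hp
  have hsub : (frobFixed K p n : Set K) ⊆ ((X ^ p ^ n - X : K[X]).roots.toFinset : Set K) := by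
    intro x hx
    have hx' : x ^ p ^ n = x := mem_frobFixed.1 hx
    simp [hne, IsRoot, hx']
  refine ⟨(Finset.finite_toSet _).subset hsub, (Set.ncard_le_ncard hsub).trans ?_⟩
  rw [Set.ncard_coe_finset]
  refine (Multiset.toFinset_card_le _).trans ((card_roots' _).trans ?_)
  rw [FiniteField.X_pow_card_pow_sub_X_natDegree_eq K hn.ne' hp]

theorem exists_card_eq_pow_of_finite (F : Subring K) [Finite F] :
    ∃ m, 0 < m ∧ (F : Set K).ncard = p ^ m ∧ ∀ x ∈ F, x ^ p ^ m = x := by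
  classical
  have := Fintype.ofFinite F
  let _ : Field F := Fintype.fieldOfDomain F
  let _ : Algebra (ZMod p) F := ZMod.algebra F p
  have hcard : Fintype.card F = p ^ Module.finrank (ZMod p) F := by
    rw [Module.card_eq_pow_finrank (K := ZMod p), ZMod.card]
  refine ⟨Module.finrank (ZMod p) F, Module.finrank_pos, ?_, fun x hx => ?_⟩
  · rw [← hcard, ← Nat.card_coe_set_eq, ← Nat.card_eq_fintype_card]
    rfl
  · have := FiniteField.pow_card (⟨x, hx⟩ : F)
    rw [hcard] at this
    exact congrArg Subtype.val this

theorem finite_closure_of_subset_frobFixed {n : ℕ} (hn : 0 < n) {s : Set K}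
    (hs : s ⊆ frobFixed K p n) : Finite (Subring.closure s) :=
  ((frobFixed_finite_and_ncard_le hn).1.subset (Subring.closure_le.2 hs)).to_subtype

/-- The subring generated by `y` and `z` is finite with `p ^ m` elements, all fixed by the `m`-th
Frobenius power. That power fixes at most `p ^ m` elements, so the subring contains every element
whose degree divides `m`, in particular `x`. -/
theorem mem_of_frobDeg_dvd_lcm (hK : ∀ x : K, ∃ n, 0 < n ∧ x ^ p ^ n = x) {S : Subring K}
    {x y z : K} (hy : y ∈ S) (hz : z ∈ S) (h : frobDeg p x ∣ Nat.lcm (frobDeg p y) (frobDeg p z)) :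
    x ∈ S := by
  have hn := Nat.lcm_pos (frobDeg_pos hK y) (frobDeg_pos hK z)
  have hfin : Finite (Subring.closure {y, z}) := by
    refine finite_closure_of_subset_frobFixed (p := p) hn ?_
    rintro w (rfl | rfl)
    · exact mem_frobFixed.2 (frobDeg_dvd_iff.1 (Nat.dvd_lcm_left _ _))
    · exact mem_frobFixed.2 (frobDeg_dvd_iff.1 (Nat.dvd_lcm_right _ _))
  obtain ⟨m, hm, hcard, hpow⟩ := exists_card_eq_pow_of_finite (p := p) (Subring.closure {y, z})
  have hym : frobDeg p y ∣ m := frobDeg_dvd_iff.2 (hpow y (Subring.subset_closure (Or.inl rfl)))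
  have hzm : frobDeg p z ∣ m := frobDeg_dvd_iff.2 (hpow z (Subring.subset_closure (Or.inr rfl)))
  have hx : x ∈ frobFixed K p m :=
    mem_frobFixed.2 (frobDeg_dvd_iff.1 (h.trans (Nat.lcm_dvd hym hzm)))
  have hF := frobFixed_finite_and_ncard_le (K := K) (p := p) hm
  have heq : (Subring.closure {y, z} : Set K) = frobFixed K p m :=
    Set.eq_of_subset_of_ncard_le (fun w hw => mem_frobFixed.2 (hpow w hw)) (by rw [hcard]; exact hF.2)
      hF.1
  have hx' : x ∈ (Subring.closure {y, z} : Set K) := heq ▸ hx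
  refine (Subring.closure_le.2 ?_) hx'
  rintro w (rfl | rfl) <;> assumption

/-- A generator of the cyclic group `Fˣ` works: its order `p ^ d - 1` rules out a smaller degree. -/
theorem exists_frobDeg_eq_card {F : Type*} [Field F] [CharP F p] [Fintype F] {d : ℕ} (hd : 0 < d)
    (hF : Fintype.card F = p ^ d) : ∃ x : F, frobDeg p x = d := by
  obtain ⟨g, hg⟩ := IsCyclic.exists_generator (α := Fˣ)
  have hp : 1 < p := (Fact.out : p.Prime).one_lt
  have hdvd : frobDeg p (g : F) ∣ d := frobDeg_dvd_iff.2 (by rw [← hF]; exact FiniteField.pow_card _)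
  refine ⟨g, Nat.dvd_antisymm hdvd ?_⟩
  have hpos := Nat.pos_of_dvd_of_pos hdvd hd
  have h1 : g ^ (p ^ frobDeg p (g : F) - 1) = 1 := by
    have h2 : g ^ p ^ frobDeg p (g : F) = g := Units.ext (by
      rw [Units.val_pow_eq_pow_val]; exact pow_frobDeg (g : F))
    have h3 : 1 ≤ p ^ frobDeg p (g : F) := Nat.one_le_pow _ _ (by omega)
    rw [← mul_right_cancel_iff (a := g), ← pow_succ, Nat.sub_add_cancel h3, h2, one_mul]
  have h4 : orderOf g = p ^ d - 1 := by
    rw [orderOf_eq_card_of_forall_mem_zpowers hg, Nat.card_units, Nat.card_eq_fintype_card, hF]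
  have h5 : p ^ d - 1 ≤ p ^ frobDeg p (g : F) - 1 := by
    refine Nat.le_of_dvd ?_ (h4 ▸ orderOf_dvd_of_pow_eq_one h1)
    have := Nat.one_lt_pow hpos.ne' hp
    omega
  have h6 : p ^ d ≤ p ^ frobDeg p (g : F) := by
    have : 1 ≤ p ^ frobDeg p (g : F) := Nat.one_le_pow _ _ (by omega)
    omega
  have h7 := (Nat.pow_le_pow_iff_right hp).1 h6
  exact (Nat.le_antisymm (Nat.le_of_dvd hd hdvd) h7).symm.dvd

theorem exists_frobDeg_eq (hK : ∀ x : K, ∃ n, 0 < n ∧ x ^ p ^ n = x) {z : K} {d : ℕ}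
    (hd : d ∣ frobDeg p z) : ∃ w : K, frobDeg p w = d := by
  classical
  have hn := frobDeg_pos hK z
  have hd0 : 0 < d := Nat.pos_of_dvd_of_pos hd hn
  have hfin : Finite (Subring.closure {z}) := by
    refine finite_closure_of_subset_frobFixed (p := p) hn ?_
    rintro w rfl
    exact mem_frobFixed.2 (pow_frobDeg w)
  have := Fintype.ofFinite (Subring.closure {z})
  let _ : Field (Subring.closure {z}) := Fintype.fieldOfDomain _
  let _ : Algebra (ZMod p) (Subring.closure {z}) := ZMod.algebra _ p
  obtain ⟨m, hm, hcard, hpow⟩ := exists_card_eq_pow_of_finite (p := p) (Subring.closure {z})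
  have hzm : frobDeg p z ∣ m := frobDeg_dvd_iff.2 (hpow z (Subring.subset_closure rfl))
  have hrank : Module.finrank (ZMod p) (Subring.closure {z}) = m := by
    have h1 : p ^ Module.finrank (ZMod p) (Subring.closure {z}) = p ^ m := by
      rw [← hcard, FiniteField.pow_finrank_eq_natCard, ← Nat.card_coe_set_eq]
      rfl
    exact Nat.pow_right_injective (Fact.out : p.Prime).two_le h1
  obtain ⟨f⟩ := FiniteField.nonempty_algHom_of_finrank_dvd (F := ZMod p) (K := GaloisField p d)
    (L := Subring.closure {z}) (by
      rw [GaloisField.finrank p hd0.ne', hrank]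
      exact hd.trans hzm)
  have := Fintype.ofFinite (GaloisField p d)
  obtain ⟨x, hx⟩ := exists_frobDeg_eq_card (F := GaloisField p d) (p := p) hd0 (by
    rw [← Nat.card_eq_fintype_card, GaloisField.card p d hd0.ne'])
  let i : GaloisField p d →+* K := (Subring.closure {z}).subtype.comp f.toRingHom
  exact ⟨i x, (frobDeg_map i x).trans hx⟩

/-! ### Maximal subrings of absolutely algebraic fields -/

theorem frobDeg_one : frobDeg p (1 : K) = 1 := Nat.dvd_one.1 (frobDeg_dvd_iff.2 (one_pow _))

variable (K p) in
/-- The elements of `K` whose absolute degree is not divisible by the prime power `q ^ e`. -/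
def primePowSubring (q e : ℕ) (hq : q.Prime) (he : 0 < e) : Subring K :=
  have key {x y z : K} (hx : ¬ q ^ e ∣ frobDeg p x)
      (hy : ¬ q ^ e ∣ frobDeg p y)
      (hz : frobDeg p z ∣ Nat.lcm (frobDeg p x) (frobDeg p y)) : ¬ q ^ e ∣ frobDeg p z := fun h =>
    (hq.pow_dvd_or_pow_dvd_of_pow_dvd_lcm (h.trans hz)).elim hx hy
  have hone : ¬ q ^ e ∣ 1 := fun h => (Nat.one_lt_pow he.ne' hq.one_lt).ne' (Nat.dvd_one.1 h)
  have hl {x y : K} : x ^ p ^ Nat.lcm (frobDeg p x) (frobDeg p y) = x :=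
    frobDeg_dvd_iff.1 (Nat.dvd_lcm_left _ _)
  have hr {x y : K} : y ^ p ^ Nat.lcm (frobDeg p x) (frobDeg p y) = y :=
    frobDeg_dvd_iff.1 (Nat.dvd_lcm_right _ _)
  { carrier := {x | ¬ q ^ e ∣ frobDeg p x}
    one_mem' := by
      rw [Set.mem_ofPred_eq, frobDeg_one]
      exact hone
    zero_mem' := by
      refine fun h => hone (h.trans (frobDeg_dvd_iff.2 (zero_pow ?_)))
      exact pow_ne_zero _ (Fact.out : p.Prime).ne_zero
    mul_mem' := fun hx hy => key hx hy (frobDeg_dvd_iff.2 (by rw [mul_pow, hl, hr]))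
    add_mem' := fun hx hy => key hx hy (frobDeg_dvd_iff.2 (by rw [add_pow_char_pow, hl, hr]))
    neg_mem' := fun {x} hx h => hx (h.trans (frobDeg_dvd_iff.2
      (by rw [← iterateFrobenius_def, map_neg, iterateFrobenius_def, pow_frobDeg]))) }

theorem mem_primePowSubring {q e : ℕ} {hq : q.Prime} {he : 0 < e} {x : K} :
    x ∈ primePowSubring K p q e hq he ↔ ¬ q ^ e ∣ frobDeg p x := Iff.rfl

/-- An element outside `M` of least degree has prime power degree `q ^ e`, since otherwise it is
generated by elements of smaller degree, which lie in `M`. Maximality then identifies `M` and also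
shows that `q ^ e` is the full `q`-part of the Steinitz number of `K`. -/
theorem exists_eq_primePowSubring (hK : ∀ x : K, ∃ n, 0 < n ∧ x ^ p ^ n = x) {M : Subring K}
    (hM : M ∈ RgMax K) : ∃ (q e : ℕ) (hq : q.Prime) (he : 0 < e),
      M = primePowSubring K p q e hq he ∧ (∃ y : K, q ^ e ∣ frobDeg p y) ∧
      ∀ x : K, ¬ q ^ (e + 1) ∣ frobDeg p x := by
  classical
  have hex : ∃ n, ∃ y ∉ M, frobDeg p y = n := by
    by_contra! h
    exact hM.1 (eq_top_iff.2 fun y _ => by_contra fun hy => h _ y hy rfl)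
  obtain ⟨y, hyM, hy⟩ := Nat.find_spec hex
  have hmin : ∀ z, frobDeg p z < frobDeg p y → z ∈ M := fun z hz => by
    by_contra hzM
    exact Nat.find_min hex (hy ▸ hz) ⟨z, hzM, rfl⟩
  have hn0 := frobDeg_pos hK y
  have hn1 : frobDeg p y ≠ 1 := fun h => hyM
    (mem_of_frobDeg_dvd_lcm hK M.one_mem M.one_mem (h ▸ one_dvd _))
  obtain ⟨q, hq, hqn⟩ := Nat.exists_prime_and_dvd hn1
  obtain ⟨e, m, hqm, hem⟩ := Nat.exists_eq_pow_mul_and_not_dvd hn0.ne' q hq.ne_one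
  have he : 0 < e := by
    rcases Nat.eq_zero_or_pos e with rfl | he
    · rw [pow_zero, one_mul] at hem
      exact absurd (hem ▸ hqn) hqm
    · exact he
  have hqe : 1 < q ^ e := Nat.one_lt_pow he.ne' hq.one_lt
  have hm0 : 0 < m := Nat.pos_of_ne_zero fun h => hqm (h ▸ dvd_zero q)
  have hyq : frobDeg p y = q ^ e := by
    by_contra hne
    have hm1 : 1 < m := by
      rcases Nat.lt_or_ge 1 m with h | h
      · exact h
      · exact absurd (by rw [hem, Nat.le_antisymm h hm0, mul_one]) hne
    obtain ⟨w, hw⟩ := exists_frobDeg_eq hK (z := y) (d := q ^ e) (hem ▸ dvd_mul_right _ _)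
    obtain ⟨v, hv⟩ := exists_frobDeg_eq hK (z := y) (d := m) (hem ▸ dvd_mul_left _ _)
    refine hyM (mem_of_frobDeg_dvd_lcm hK (hmin w ?_) (hmin v ?_) ?_)
    · rw [hw, hem]
      exact lt_mul_of_one_lt_right (by omega) hm1
    · rw [hv, hem]
      exact lt_mul_of_one_lt_left hm0 hqe
    · rw [hw, hv, (((Nat.Prime.coprime_iff_not_dvd hq).2 hqm).pow_left e).lcm_eq_mul, hem]
  have hle : M ≤ primePowSubring K p q e hq he := fun x hx hd =>
    hyM (mem_of_frobDeg_dvd_lcm hK hx hx (by rwa [Nat.lcm_self, hyq]))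
  have heq : M = primePowSubring K p q e hq he := by
    refine (hM.le_iff.1 hle).elim (fun h => ?_) Eq.symm
    have : y ∈ primePowSubring K p q e hq he := h ▸ Subring.mem_top y
    exact absurd hyq.symm.dvd this
  refine ⟨q, e, hq, he, heq, ⟨y, hyq.symm.dvd⟩, fun x => ?_⟩
  -- The subring for `q ^ (e + 1)` contains `M` and also `y`, so it is everything.
  have hlt : M < primePowSubring K p q (e + 1) hq e.succ_pos := by
    refine SetLike.lt_iff_le_and_exists.2 ⟨fun z hz hd => hle hz ((pow_dvd_pow q e.le_succ).trans hd),
      y, fun hd => ?_, hyM⟩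
    rw [hyq] at hd
    exact absurd ((Nat.pow_dvd_pow_iff_le_right hq.one_lt).1 hd) (by omega)
  have : x ∈ primePowSubring K p q (e + 1) hq e.succ_pos := hM.2 _ hlt ▸ Subring.mem_top x
  exact this

/-- A strictly larger subring contains some `w` with `q ^ e ∣ frobDeg p w`. Any `z` has degree `q ^
f * m` with `f ≤ e` and `q ∤ m`, and is generated by `w` together with an element of degree `m`. -/
theorem primePowSubring_mem_RgMax (hK : ∀ x : K, ∃ n, 0 < n ∧ x ^ p ^ n = x) {q e : ℕ}
    (hq : q.Prime) (he : 0 < e) {y : K} (hy : q ^ e ∣ frobDeg p y)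
    (hmax : ∀ x : K, ¬ q ^ (e + 1) ∣ frobDeg p x) : primePowSubring K p q e hq he ∈ RgMax K := by
  refine ⟨fun h => ?_, fun N hN => eq_top_iff.2 fun z _ => ?_⟩
  · have : y ∈ primePowSubring K p q e hq he := h ▸ Subring.mem_top y
    exact this hy
  · obtain ⟨hle, w, hwN, hw⟩ := SetLike.lt_iff_le_and_exists.1 hN
    rw [mem_primePowSubring, not_not] at hw
    obtain ⟨f, m, hqm, hfm⟩ := Nat.exists_eq_pow_mul_and_not_dvd (frobDeg_pos hK z).ne' q hq.ne_one
    have hfe : f ≤ e := by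
      by_contra! hlt
      exact hmax z ((pow_dvd_pow q hlt).trans (hfm ▸ dvd_mul_right _ _))
    obtain ⟨v, hv⟩ := exists_frobDeg_eq hK (z := z) (d := m) (hfm ▸ dvd_mul_left _ _)
    have hvN : v ∈ N := hle (fun hd => hqm (hv ▸ (dvd_pow_self q he.ne').trans hd))
    refine mem_of_frobDeg_dvd_lcm hK hvN hwN ?_
    rw [hv, hfm]
    exact Nat.Coprime.mul_dvd_of_dvd_of_dvd (((Nat.Prime.coprime_iff_not_dvd hq).2 hqm).pow_left f)
      (((pow_dvd_pow q hfe).trans hw).trans (Nat.dvd_lcm_right _ _)) (Nat.dvd_lcm_left _ _)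

theorem prime_eq_of_primePowSubring_eq (hK : ∀ x : K, ∃ n, 0 < n ∧ x ^ p ^ n = x) {q e r f : ℕ}
    {hq : q.Prime} {he : 0 < e} {hr : r.Prime} {hf : 0 < f} {y : K} (hy : q ^ e ∣ frobDeg p y)
    (h : primePowSubring K p q e hq he = primePowSubring K p r f hr hf) : q = r := by
  obtain ⟨w, hw⟩ := exists_frobDeg_eq hK hy
  by_contra hne
  have h1 : w ∈ primePowSubring K p r f hr hf := fun hd => by
    rw [hw] at hd
    exact hne ((Nat.prime_dvd_prime_iff_eq hr hq).1
      (hr.dvd_of_dvd_pow ((dvd_pow_self r hf.ne').trans hd))).symm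
  rw [← h] at h1
  exact h1 hw.symm.dvd

end

/-! ### Finite extensions of absolutely algebraic fields -/

/-- Some Frobenius power `φ`, with exponent `N` not divisible by `q ^ (e + 1)`, fixes the
coefficients of the minimal polynomial of `y` and so permutes its roots. Hence `φ^[r] y = y` for
some `0 < r ≤ [L : K]`, and the degree of `y` divides `N * r`. -/
theorem exists_bound_pow_dvd_frobDeg {K L : Type*} [Field K] [Field L] [Algebra K L]
    [FiniteDimensional K L] {p : ℕ} [Fact p.Prime] [CharP K p] [CharP L p] {q e : ℕ} (hq : q.Prime)
    (hmax : ∀ x : K, ¬ q ^ (e + 1) ∣ frobDeg p x) (y : L) :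
    ¬ q ^ (e + Module.finrank K L) ∣ frobDeg p y := by
  classical
  let f := minpoly K y
  have hint : IsIntegral K y := Algebra.IsIntegral.isIntegral y
  have hf : f.Monic := minpoly.monic hint
  obtain ⟨N, hN, hcoeff⟩ : ∃ N, ¬ q ^ (e + 1) ∣ N ∧ ∀ i ∈ f.support, frobDeg p (f.coeff i) ∣ N := by
    induction f.support using Finset.induction_on with
    | empty => exact ⟨1, fun h => hmax 1 (h.trans (one_dvd _)), by simp⟩
    | insert a s _ ih =>
      obtain ⟨N, hN, h⟩ := ih
      refine ⟨Nat.lcm (frobDeg p (f.coeff a)) N, fun hd =>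
        (hq.pow_dvd_or_pow_dvd_of_pow_dvd_lcm hd).elim (hmax _) hN, fun i hi => ?_⟩
      rcases Finset.mem_insert.1 hi with rfl | hi
      · exact Nat.dvd_lcm_left _ _
      · exact (h i hi).trans (Nat.dvd_lcm_right _ _)
  have hfix : f.map (iterateFrobenius K p N) = f := by
    ext i
    rw [coeff_map, iterateFrobenius_def]
    by_cases hi : i ∈ f.support
    · exact frobDeg_dvd_iff.1 (hcoeff i hi)
    · rw [notMem_support_iff.1 hi, zero_pow (pow_ne_zero _ (Fact.out : p.Prime).ne_zero)]
  let φ := iterateFrobenius L p N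
  have hroot : ∀ z ∈ f.rootSet L, φ z ∈ f.rootSet L := fun z hz => by
    rw [mem_rootSet] at hz ⊢
    refine ⟨hz.1, ?_⟩
    have hcomp : (algebraMap K L).comp (iterateFrobenius K p N) = φ.comp (algebraMap K L) := by
      ext c
      simp [φ, iterateFrobenius_def]
    have h1 : eval₂ ((algebraMap K L).comp (iterateFrobenius K p N)) (φ z) f = 0 := by
      rw [hcomp, ← hom_eval₂, ← aeval_def, hz.2, map_zero]
    rwa [← eval₂_map, hfix, ← aeval_def] at h1
  have horbit : ∀ i : ℕ, φ^[i] y ∈ f.rootSet L := fun i => by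
    induction i with
    | zero => exact mem_rootSet.2 ⟨hf.ne_zero, minpoly.aeval K y⟩
    | succ i ih =>
      rw [Function.iterate_succ_apply']
      exact hroot _ ih
  have hcard : (f.aroots L).toFinset.card < (Finset.range (Module.finrank K L + 1)).card := by
    rw [Finset.card_range, Nat.lt_succ_iff]
    exact (Multiset.toFinset_card_le _).trans ((card_roots' _).trans
      (natDegree_map_le.trans (minpoly.natDegree_le y)))
  obtain ⟨i, hi, j, hj, hne, hij⟩ := Finset.exists_ne_map_eq_of_card_lt_of_maps_to hcard
    (f := fun i => φ^[i] y) (fun i _ => horbit i)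
  have hper : ∃ r, 0 < r ∧ r ≤ Module.finrank K L ∧ φ^[r] y = y := by
    have key : ∀ i j : ℕ, i < j → j ≤ Module.finrank K L → φ^[i] y = φ^[j] y →
        ∃ r, 0 < r ∧ r ≤ Module.finrank K L ∧ φ^[r] y = y := fun i j hlt hj h => by
      refine ⟨j - i, by omega, by omega, (φ.injective.iterate i) ?_⟩
      rw [← Function.iterate_add_apply, Nat.add_sub_cancel' hlt.le, h]
    rw [Finset.mem_range] at hi hj
    rcases lt_or_gt_of_ne hne with h | h
    · exact key i j h (by omega) hij
    · exact key j i h (by omega) hij.symm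
  obtain ⟨r, hr0, hr, hry⟩ := hper
  have hdvd : frobDeg p y ∣ N * r := by
    rw [frobDeg_dvd_iff, ← iterate_frobenius, Function.iterate_mul, ← coe_iterateFrobenius]
    exact hry
  intro hd
  -- The second alternative fails by size: `r ≤ [L : K] < q ^ [L : K]`.
  rcases hq.pow_add_dvd_mul (hd.trans hdvd) with h | h
  · exact hN h
  · exact absurd (Nat.le_of_dvd hr0 h) (not_le.2 (hr.trans_lt (Nat.lt_pow_self hq.one_lt)))

theorem RgMax_finite_of_finiteDimensional {K L : Type*} [Field K] [Field L] [Algebra K L]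
    [FiniteDimensional K L] (habs : IsAbsolutelyAlgebraic L) (hL : (RgMax L).Finite) :
    (RgMax K).Finite := by
  obtain ⟨p, hp, hcL, hxL⟩ := habs
  have : Fact p.Prime := ⟨hp⟩
  have hcK : CharP K p := ((algebraMap K L).charP_iff (algebraMap K L).injective p).2 hcL
  have hxK : ∀ x : K, ∃ n, 0 < n ∧ x ^ p ^ n = x := fun x => by
    obtain ⟨n, hn, h⟩ := hxL (algebraMap K L x)
    exact ⟨n, hn, (algebraMap K L).injective (by rw [map_pow, h])⟩
  have hmain : ∀ M : RgMax K, ∃ (q e : ℕ) (hq : q.Prime) (he : 0 < e) (e' : ℕ) (he' : 0 < e'),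
      M = primePowSubring K p q e hq he ∧ (∃ y : K, q ^ e ∣ frobDeg p y) ∧
      (∀ x : K, ¬ q ^ (e + 1) ∣ frobDeg p x) ∧ (∃ y : L, q ^ e' ∣ frobDeg p y) ∧
      primePowSubring L p q e' hq he' ∈ RgMax L := by
    classical
    rintro ⟨M, hM⟩
    obtain ⟨q, e, hq, he, hMe, ⟨y, hy⟩, hmax⟩ := exists_eq_primePowSubring hxK hM
    -- The exponent of `q` for `L` is finite by the degree bound, and at least `e`, hence positive,
    -- because `K` embeds in `L`.
    have hex : ∃ n, ∀ x : L, ¬ q ^ (n + 1) ∣ frobDeg p x :=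
      ⟨e + Module.finrank K L, fun x hd => exists_bound_pow_dvd_frobDeg hq hmax x
        ((pow_dvd_pow q (Nat.le_succ _)).trans hd)⟩
    have hspec := Nat.find_spec hex
    have hee : e ≤ Nat.find hex := by
      by_contra! hlt
      refine hspec (algebraMap K L y) ?_
      rw [frobDeg_map]
      exact (pow_dvd_pow q hlt).trans hy
    have hpos : 0 < Nat.find hex := he.trans_le hee
    have hmin := Nat.find_min hex (Nat.sub_one_lt hpos.ne')
    push Not at hmin
    obtain ⟨z, hz⟩ := hmin
    rw [Nat.sub_add_cancel hpos] at hz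
    exact ⟨q, e, hq, he, _, hpos, hMe, ⟨y, hy⟩, hmax, ⟨z, hz⟩,
      primePowSubring_mem_RgMax hxL hq hpos hz hspec⟩
  choose q e hq he e' he' hMe hy hmax hz hmem using hmain
  have : Finite (RgMax L) := hL
  refine Finite.of_injective
    (fun M => (⟨primePowSubring L p (q M) (e' M) (hq M) (he' M), hmem M⟩ : RgMax L)) ?_
  intro M M' h
  obtain ⟨z, hz⟩ := hz M
  have hqq : q M = q M' := prime_eq_of_primePowSubring_eq hxL (hq := hq M)
    (he := he' M) (hr := hq M') (hf := he' M') hz (congrArg Subtype.val h)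
  -- The prime alone determines `M`, since `e` is the exact exponent of `q` for `K`.
  have key : ∀ M M', q M = q M' → e M ≤ e M' := fun M M' hqq => by
    by_contra! hlt
    obtain ⟨y, hy⟩ := hy M
    exact hmax M' y (hqq ▸ (pow_dvd_pow (q M) hlt).trans hy)
  have hee : e M = e M' := le_antisymm (key M M' hqq) (key M' M hqq.symm)
  refine Subtype.ext ?_
  rw [hMe M, hMe M']
  ext x
  rw [mem_primePowSubring, mem_primePowSubring, hqq, hee]

/-! ### Maximal subrings of reduced semilocal rings up to isomorphism -/

theorem map_mem_RgMax {A B : Type*} [CommRing A] [CommRing B] {f : A →+* B}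
    (hf : Function.Surjective f) {S : Subring A} (hS : S ∈ RgMax A) (h : S.map f ≠ ⊤) :
    S.map f ∈ RgMax B ∧ S = (S.map f).comap f := by
  have hne : (S.map f).comap f ≠ ⊤ := fun htop => h (eq_top_iff.2 fun b _ => by
    obtain ⟨a, rfl⟩ := hf b
    have : a ∈ (S.map f).comap f := htop ▸ Subring.mem_top a
    exact this)
  have heq : S = (S.map f).comap f :=
    ((hS.le_iff.1 ((Subring.gc_map_comap f).le_u_l S)).resolve_left hne).symm
  refine ⟨⟨h, fun N hN => ?_⟩, heq⟩
  have hlt : S < N.comap f := by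
    obtain ⟨hle, b, hbN, hb⟩ := SetLike.lt_iff_le_and_exists.1 hN
    obtain ⟨a, rfl⟩ := hf b
    exact SetLike.lt_iff_le_and_exists.2
      ⟨fun s hs => hle ⟨s, hs, rfl⟩, a, hbN, fun ha => hb ⟨a, ha, rfl⟩⟩
  have htop := hS.2 _ hlt
  rw [eq_top_iff]
  intro b _
  obtain ⟨a, rfl⟩ := hf b
  have : a ∈ N.comap f := htop ▸ Subring.mem_top a
  exact this

theorem finitelyManyMaximalSubringsUpToIso_of_cover {A ι : Type*} [CommRing A] [Finite ι]
    {F : Set (Subring A)} (hF : F.Finite) (Q : ι → Type*) [∀ i, CommRing (Q i)]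
    (h : ∀ S ∈ RgMax A, S ∈ F ∨ ∃ i, Nonempty (S ≃+* Q i)) :
    FinitelyManyMaximalSubringsUpToIso A := by
  let J := {i | ∃ S ∈ RgMax A, Nonempty (S ≃+* Q i)}
  choose g hg hgQ using fun i : J => i.2
  refine ⟨(F ∩ RgMax A) ∪ Set.range g, (hF.inter_of_left _).union (Set.finite_range g), ?_, ?_⟩
  · rintro S (hS | ⟨i, rfl⟩)
    · exact hS.2
    · exact hg i
  · intro S hS
    rcases h S hS with hSF | ⟨i, ⟨e⟩⟩
    · exact ⟨S, Or.inl ⟨hSF, hS⟩, ⟨RingEquiv.refl _⟩⟩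
    · obtain ⟨e'⟩ := hgQ ⟨i, S, hS, ⟨e⟩⟩
      exact ⟨_, Or.inr ⟨_, rfl⟩, ⟨e.trans e'.symm⟩⟩

theorem isCoprime_of_isMaximal_of_ne {A : Type*} [CommRing A] {M N : Ideal A} (hM : M.IsMaximal)
    (hN : N.IsMaximal) (h : M ≠ N) : IsCoprime M N :=
  Ideal.isCoprime_iff_sup_eq.2 (hM.coprime_of_ne hN h)

/-- A maximal subring projecting onto every residue field identifies two residue fields; hence it is
isomorphic to the quotient of `A` that forgets one of the two. -/
theorem exists_ringEquiv_quotient {A : Type*} [CommRing A] (hA : SemilocalRing A)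
    (hJ : ∀ a : A, (∀ M : Ideal A, M.IsMaximal → a ∈ M) → a = 0) {S : Subring A} (hS : S ∈ RgMax A)
    (hsurj : ∀ M : Ideal A, M.IsMaximal → ∀ a, ∃ s ∈ S, s - a ∈ M) :
    ∃ M' : {M : Ideal A | M.IsMaximal},
      Nonempty (S ≃+* A ⧸ (⨅ N : {N : {M : Ideal A | M.IsMaximal} // N ≠ M'}, (N.1 : Ideal A))) := by
  classical
  have hfin : Finite {M : Ideal A | M.IsMaximal} := hA
  let P : {M : Ideal A | M.IsMaximal} → Ideal S := fun M => M.1.comap S.subtype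
  have hP : ∀ M, (P M).IsMaximal := fun M => by
    have := M.2
    have hM : M.1.IsMaximal := M.2
    let _ : Field (A ⧸ M.1) := Ideal.Quotient.field M.1
    have h1 : Function.Surjective ((Ideal.Quotient.mk M.1).comp S.subtype) := fun x => by
      obtain ⟨a, rfl⟩ := Ideal.Quotient.mk_surjective x
      obtain ⟨s, hs, hsa⟩ := hsurj M.1 hM a
      exact ⟨⟨s, hs⟩, Ideal.Quotient.eq.2 hsa⟩
    have h2 := RingHom.ker_isMaximal_of_surjective _ h1
    rwa [← RingHom.comap_ker, Ideal.mk_ker] at h2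
  -- If the contractions to `S` were distinct, the Chinese remainder theorem in `S` would produce
  -- every element of `A`.
  have hninj : ¬ Function.Injective P := fun hinj => hS.1 (eq_top_iff.2 fun a _ => by
    choose s hs hsa using fun M : {M : Ideal A | M.IsMaximal} => hsurj M.1 M.2 a
    obtain ⟨r, hr⟩ := Ideal.exists_forall_sub_mem_ideal (I := P)
      (fun M N h => isCoprime_of_isMaximal_of_ne (hP M) (hP N) (hinj.ne h)) (fun M => ⟨s M, hs M⟩)
    have : (r : A) - a = 0 := hJ _ fun M hM => by
      have := M.add_mem (hr ⟨M, hM⟩) (hsa ⟨M, hM⟩)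
      simpa using this
    exact sub_eq_zero.1 this ▸ r.2)
  simp only [Function.Injective, not_forall] at hninj
  obtain ⟨M, M', hMM', hne⟩ := hninj
  have hiff : ∀ s ∈ S, s ∈ M'.1 → s ∈ M.1 := fun s hs h => by
    have : (⟨s, hs⟩ : S) ∈ P M := hMM' ▸ h
    exact this
  have hiff' : ∀ s ∈ S, s ∈ M.1 → s ∈ M'.1 := fun s hs h => by
    have : (⟨s, hs⟩ : S) ∈ P M' := hMM' ▸ h
    exact this
  -- `S` is a union of cosets of `M ⊓ M'`: its image modulo this ideal is proper, because elements
  -- of `S` vanish in both residue fields or in neither, so by maximality `S` is the preimage of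
  -- that image.
  have hclosed : ∀ b, ∀ s ∈ S, b - s ∈ M.1 → b - s ∈ M'.1 → b ∈ S := by
    let f := Ideal.Quotient.mk (M.1 ⊓ M'.1)
    have hmem : ∀ b, b ∈ (S.map f).comap f ↔ ∃ s ∈ S, b - s ∈ M.1 ∧ b - s ∈ M'.1 := fun b => by
      refine ⟨fun ⟨s, hs, hsb⟩ => ⟨s, hs, Ideal.Quotient.eq.1 hsb.symm⟩, fun ⟨s, hs, h⟩ =>
        ⟨s, hs, (Ideal.Quotient.eq.2 h).symm⟩⟩
    have hnetop : (S.map f).comap f ≠ ⊤ := fun htop => hne (Subtype.ext (by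
      refine (M'.2.eq_of_le M.2.ne_top fun x hx => ?_).symm
      obtain ⟨s, hs, h1, h2⟩ := (hmem x).1 (htop ▸ Subring.mem_top x)
      have hs' : s ∈ M'.1 := by simpa using M'.1.sub_mem hx h2
      simpa using M.1.add_mem h1 (hiff s hs hs')))
    have heq := (hS.le_iff.1 ((Subring.gc_map_comap f).le_u_l S)).resolve_left hnetop
    intro b s hs h1 h2
    rw [← heq]
    exact (hmem b).2 ⟨s, hs, h1, h2⟩
  refine ⟨M', ⟨RingEquiv.ofBijective ((Ideal.Quotient.mk _).comp S.subtype) ⟨?_, ?_⟩⟩⟩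
  · rw [injective_iff_map_eq_zero]
    rintro ⟨s, hs⟩ h
    have h1 := Ideal.Quotient.eq_zero_iff_mem.1 h
    simp only [Ideal.mem_iInf] at h1
    have h2 : s = 0 := hJ s fun N hN => by
      by_cases hNM : (⟨N, hN⟩ : {M : Ideal A | M.IsMaximal}) = M'
      · have := hiff' s hs (h1 ⟨M, hne⟩)
        rwa [← hNM] at this
      · exact h1 ⟨⟨N, hN⟩, hNM⟩
    exact Subtype.ext h2
  · intro x
    obtain ⟨a, rfl⟩ := Ideal.Quotient.mk_surjective x
    obtain ⟨s, hs, hsa⟩ := hsurj M.1 M.2 a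
    obtain ⟨b, hb⟩ := Ideal.exists_forall_sub_mem_ideal
      (I := fun M : {M : Ideal A | M.IsMaximal} => M.1)
      (fun M N h => isCoprime_of_isMaximal_of_ne M.2 N.2 fun h' => h (Subtype.ext h'))
      -- Correct `a` only at `M'`, so that `b` agrees with `s` modulo both `M` and `M'` and
      -- therefore lies in `S`.
      (fun N => if N = M' then s else a)
    have hbM' : b - s ∈ M'.1 := by simpa using hb M'
    have hbN : ∀ N, N ≠ M' → b - a ∈ N.1 := fun N hN => by simpa [hN] using hb N
    have hbM : b - s ∈ M.1 := by
      have := M.1.sub_mem (hbN M hne) hsa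
      simpa using this
    refine ⟨⟨b, hclosed b s hs hbM hbM'⟩, Ideal.Quotient.eq.2 ?_⟩
    rw [Ideal.mem_iInf]
    exact fun N => hbN N.1 N.2

theorem finitelyManyMaximalSubringsUpToIso_of_semilocal {A : Type*} [CommRing A]
    (hA : SemilocalRing A) (hJ : ∀ a : A, (∀ M : Ideal A, M.IsMaximal → a ∈ M) → a = 0)
    (hfin : ∀ M : Ideal A, M.IsMaximal → (RgMax (A ⧸ M)).Finite) :
    FinitelyManyMaximalSubringsUpToIso A := by
  have : Finite {M : Ideal A | M.IsMaximal} := hA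
  refine finitelyManyMaximalSubringsUpToIso_of_cover
    (F := ⋃ M : {M : Ideal A | M.IsMaximal}, Subring.comap (Ideal.Quotient.mk M.1) '' RgMax (A ⧸ M.1))
    (Set.finite_iUnion fun M => (hfin M.1 M.2).image _)
    (fun M' : {M : Ideal A | M.IsMaximal} =>
      A ⧸ (⨅ N : {N : {M : Ideal A | M.IsMaximal} // N ≠ M'}, (N.1 : Ideal A))) fun S hS => ?_
  by_cases h : ∃ M : Ideal A, M.IsMaximal ∧ S.map (Ideal.Quotient.mk M) ≠ ⊤
  · obtain ⟨M, hM, hne⟩ := h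
    obtain ⟨h1, h2⟩ := map_mem_RgMax Ideal.Quotient.mk_surjective hS hne
    exact Or.inl (Set.mem_iUnion.2 ⟨⟨M, hM⟩, _, h1, h2.symm⟩)
  · push Not at h
    refine Or.inr (exists_ringEquiv_quotient hA hJ hS fun M hM a => ?_)
    have : Ideal.Quotient.mk M a ∈ S.map (Ideal.Quotient.mk M) := h M hM ▸ Subring.mem_top _
    obtain ⟨s, hs, hsa⟩ := this
    exact ⟨s, hs, Ideal.Quotient.eq.1 hsa⟩

/-! ### Integrality, artinian descent and dimension zero -/

theorem SemilocalRing.of_surjective {A B : Type*} [CommRing A] [CommRing B] (f : A →+* B)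
    (hf : Function.Surjective f) (hA : SemilocalRing A) : SemilocalRing B := by
  refine Set.Finite.of_finite_image (f := Ideal.comap f) (hA.subset ?_)
    (Ideal.comap_injective_of_surjective f hf).injOn
  rintro _ ⟨M, hM, rfl⟩
  have : M.IsMaximal := hM
  exact Ideal.comap_isMaximal_of_surjective f hf

theorem IsField.semilocalRing {A : Type*} [CommRing A] (hA : IsField A) : SemilocalRing A := by
  let _ := hA.toField
  exact (Set.finite_singleton (⊥ : Ideal A)).subset fun M hM =>
    (Ideal.eq_bot_or_top M).resolve_right (Ideal.IsMaximal.ne_top hM)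

theorem isField_of_RgMax_finite {k B : Type*} [CommRing k] (hk : IsField k) [CommRing B] [IsDomain B]
    [Algebra k B] [Algebra.FiniteType k B] (hB : (RgMax B).Finite) : IsField B := by
  let _ := hk.toField
  have := isAlgebraic_of_RgMax_finite (k := k) hB
  have : Algebra.IsIntegral k B := Algebra.IsAlgebraic.isIntegral
  exact isField_of_isIntegral_of_isField' hk

/-- The values at `t` of monic polynomials form a multiplicative set; if it omitted `0`, some prime
would be disjoint from it. -/
theorem isIntegral_of_forall_isPrime {R T : Type*} [CommRing R] [CommRing T] [Algebra R T] {t : T}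
    (h : ∀ Q : Ideal T, Q.IsPrime → ∃ f : R[X], f.Monic ∧ aeval t f ∈ Q) : IsIntegral R t := by
  let S : Submonoid T :=
    { carrier := {x | ∃ f : R[X], f.Monic ∧ aeval t f = x}
      one_mem' := ⟨1, monic_one, map_one _⟩
      mul_mem' := by
        rintro _ _ ⟨f, hf, rfl⟩ ⟨g, hg, rfl⟩
        exact ⟨f * g, hf.mul hg, map_mul _ _ _⟩ }
  by_contra hint
  have h0 : Disjoint ((⊥ : Ideal T) : Set T) S := by
    rw [Set.disjoint_left]
    rintro x hx ⟨f, hf, hfx⟩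
    exact hint ⟨f, hf, by rw [← aeval_def, hfx]; exact hx⟩
  obtain ⟨Q, hQ, -, hdisj⟩ := Ideal.exists_le_prime_disjoint ⊥ S h0
  obtain ⟨f, hf, hfQ⟩ := h Q hQ
  exact Set.disjoint_left.1 hdisj hfQ ⟨f, hf, rfl⟩

theorem isIntegral_of_isAbsolutelyAlgebraic {R T : Type*} [CommRing R] [CommRing T] [Algebra R T]
    (h : ∀ Q : Ideal T, Q.IsPrime → IsAbsolutelyAlgebraic (T ⧸ Q)) : Algebra.IsIntegral R T := by
  refine ⟨fun t => isIntegral_of_forall_isPrime fun Q hQ => ?_⟩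
  obtain ⟨p, hp, -, hx⟩ := h Q hQ
  obtain ⟨n, hn, hxn⟩ := hx (Ideal.Quotient.mk Q t)
  refine ⟨X ^ p ^ n - X, monic_X_pow_sub ?_, ?_⟩
  · refine degree_X_le.trans_lt ?_
    exact_mod_cast Nat.one_lt_pow hn.ne' hp.one_lt
  · rw [map_sub, map_pow, aeval_X, ← Ideal.Quotient.eq_zero_iff_mem, map_sub, map_pow, hxn, sub_self]

/-- Induction along a composition series: a simple factor `T ⧸ I` is finite-dimensional over the
residue field of `R` at the contraction of `I`. The `R`-structure is quantified after the colon so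
that the induction can vary the module. -/
theorem isArtinian_of_isFiniteLength {R T M : Type*} [CommRing R] [CommRing T] [Algebra R T]
    [Module.Finite R T] [AddCommGroup M] [Module T M] (hM : IsFiniteLength T M) :
    ∀ [Module R M] [IsScalarTower R T M], IsArtinian R M := by
  induction hM with
  | of_subsingleton => intros; infer_instance
  | @of_simple_quotient M _ _ N hsimple _ ih =>
    intro _ _
    have hN : IsArtinian R (N.restrictScalars R) := ih
    obtain ⟨I, hI, ⟨e⟩⟩ := isSimpleModule_iff_quot_maximal.1 hsimple
    have hP : (I.comap (algebraMap R T)).IsMaximal :=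
      Ideal.isMaximal_comap_of_isIntegral_of_isMaximal I
    let _ : Field (R ⧸ I.comap (algebraMap R T)) := Ideal.Quotient.field _
    have : Module.Finite (R ⧸ I.comap (algebraMap R T)) (T ⧸ I) :=
      Module.Finite.of_restrictScalars_finite R _ _
    have : IsArtinian (R ⧸ I.comap (algebraMap R T)) (T ⧸ I) := inferInstance
    have hTI : IsArtinian R (T ⧸ I) := isArtinian_of_surjective_algebraMap
      (R := R ⧸ I.comap (algebraMap R T)) Ideal.Quotient.mk_surjective
    have hQ : IsArtinian R (M ⧸ N) := isArtinian_of_linearEquiv (e.restrictScalars R).symm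
    have : IsArtinian R (M ⧸ N.restrictScalars R) := hQ
    exact (isArtinian_iff_submodule_quotient (N.restrictScalars R)).2 ⟨hN, this⟩

theorem isArtinianRing_of_finite_of_injective {R T : Type*} [CommRing R] [CommRing T] [Algebra R T]
    [Module.Finite R T] (hinj : Function.Injective (algebraMap R T)) [IsArtinianRing T] :
    IsArtinianRing R :=
  have : IsArtinian R T := isArtinian_of_isFiniteLength
    (isFiniteLength_iff_isNoetherian_isArtinian.2 ⟨inferInstance, ‹IsArtinianRing T›⟩)
  isArtinian_of_injective (Algebra.linearMap R T) hinj

theorem isAbsolutelyAlgebraic_of_isField_comap {R T : Type*} [CommRing R] [CommRing T] [Algebra R T]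
    [Algebra.FiniteType R T] (hfin : (RgMax T).Finite) {Q : Ideal T} (hQ : Q.IsPrime)
    (h : (Q.comap (algebraMap R T)).IsMaximal) : IsAbsolutelyAlgebraic (T ⧸ Q) := by
  have hfinQ := RgMax_finite_of_surjective (Ideal.Quotient.mk Q) Ideal.Quotient.mk_surjective hfin
  have : Algebra.FiniteType R (T ⧸ Q) :=
    Algebra.FiniteType.of_surjective (Ideal.Quotient.mkₐ R Q) Ideal.Quotient.mk_surjective
  have : Algebra.FiniteType (R ⧸ Q.comap (algebraMap R T)) (T ⧸ Q) :=
    Algebra.FiniteType.of_restrictScalars_finiteType R _ _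
  have hfield := isField_of_RgMax_finite (k := R ⧸ Q.comap (algebraMap R T)) (B := T ⧸ Q)
    ((Ideal.Quotient.maximal_ideal_iff_isField_quotient _).1 h) hfinQ
  exact isAbsolutelyAlgebraic_of_semilocal (R := T ⧸ Q) (T := T ⧸ Q) Function.injective_id
    hfield.semilocalRing hfinQ

theorem quotientMap_comap_injective {R T : Type*} [CommRing R] [CommRing T] [Algebra R T]
    (Q : Ideal T) :
    Function.Injective (algebraMap (R ⧸ Q.comap (algebraMap R T)) (T ⧸ Q)) :=
  Ideal.quotientMap_injective

theorem isMaximal_of_isAbsolutelyAlgebraic {A : Type*} [CommRing A] {P : Ideal A} (hP : P.IsPrime)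
    (h : IsAbsolutelyAlgebraic (A ⧸ P)) : P.IsMaximal :=
  (Ideal.Quotient.maximal_ideal_iff_isField_quotient P).2 h.isField

/-- Minimal primes of `R` are contracted from `T` by injectivity alone, so no integrality is needed
yet; each quotient of `R` by one is semilocal inside some `T ⧸ Q`, hence a field. -/
theorem krullDimLE_zero_of_semilocal {R T : Type*} [CommRing R] [CommRing T] [Algebra R T]
    (hinj : Function.Injective (algebraMap R T)) (hfin : (RgMax T).Finite)
    (hR : SemilocalRing R) : Ring.KrullDimLE 0 R := by
  rw [Ring.krullDimLE_zero_iff_forall_minimalPrimes_isMaximal]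
  intro P hP
  obtain ⟨Q, hQ, rfl⟩ := Ideal.exists_comap_eq_of_mem_minimalPrimes_of_injective hinj P hP
  refine isMaximal_of_isAbsolutelyAlgebraic (hQ.comap _) ?_
  exact isAbsolutelyAlgebraic_of_semilocal (T := T ⧸ Q) (quotientMap_comap_injective Q)
    (hR.of_surjective _ Ideal.Quotient.mk_surjective)
    (RgMax_finite_of_surjective _ Ideal.Quotient.mk_surjective hfin)

theorem zeroDimensional_iff {A : Type*} [CommRing A] [Nontrivial A] :
    ZeroDimensional A ↔ Ring.KrullDimLE 0 A := ringKrullDimZero_iff_ringKrullDim_eq_zero.symm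

theorem isAbsolutelyAlgebraic_quotient_of_or {R T : Type*} [CommRing R] [CommRing T]
    [Nontrivial R] [Nontrivial T] [Algebra R T] [Algebra.FiniteType R T]
    (hinj : Function.Injective (algebraMap R T)) (hfin : (RgMax T).Finite)
    (h : ZeroDimensional R ∨ ZeroDimensional T ∨ SemilocalRing R ∨ SemilocalRing T)
    (Q : Ideal T) (hQ : Q.IsPrime) : IsAbsolutelyAlgebraic (T ⧸ Q) := by
  have hfinQ := RgMax_finite_of_surjective (Ideal.Quotient.mk Q) Ideal.Quotient.mk_surjective hfin
  have hT : SemilocalRing (T ⧸ Q) → IsAbsolutelyAlgebraic (T ⧸ Q) := fun h =>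
    isAbsolutelyAlgebraic_of_semilocal (T := T ⧸ Q) Function.injective_id h hfinQ
  have hR : Ring.KrullDimLE 0 R → IsAbsolutelyAlgebraic (T ⧸ Q) := fun h =>
    isAbsolutelyAlgebraic_of_isField_comap (R := R) hfin hQ
      (Ring.krullDimLE_zero_iff.1 h _ (hQ.comap _))
  rcases h with h | h | h | h
  · exact hR (zeroDimensional_iff.1 h)
  · exact hT ((Ideal.Quotient.maximal_ideal_iff_isField_quotient Q).1
      (Ring.krullDimLE_zero_iff.1 (zeroDimensional_iff.1 h) Q hQ)).semilocalRing
  · exact hR (krullDimLE_zero_of_semilocal hinj hfin h)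
  · exact hT (h.of_surjective _ Ideal.Quotient.mk_surjective)

/-! ### Transfer between `R` and `T` -/

section

variable {R T : Type*} [CommRing R] [CommRing T] [Algebra R T]

theorem krullDimLE_zero_of_isAbsolutelyAlgebraic
    (h : ∀ Q : Ideal T, Q.IsPrime → IsAbsolutelyAlgebraic (T ⧸ Q)) : Ring.KrullDimLE 0 T :=
  Ring.krullDimLE_zero_iff.2 fun Q hQ => isMaximal_of_isAbsolutelyAlgebraic hQ (h Q hQ)

theorem isAbsolutelyAlgebraic_quotient_of_isIntegral [Algebra.IsIntegral R T]
    (hinj : Function.Injective (algebraMap R T))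
    (h : ∀ Q : Ideal T, Q.IsPrime → IsAbsolutelyAlgebraic (T ⧸ Q)) (P : Ideal R) (hP : P.IsPrime) :
    IsAbsolutelyAlgebraic (R ⧸ P) := by
  obtain ⟨Q, -, hQ, rfl⟩ := Ideal.exists_ideal_over_prime_of_isIntegral (S := T) P ⊥
    (by rw [Ideal.comap_bot_of_injective _ hinj]; exact bot_le)
  exact (h Q hQ).of_injective _ (quotientMap_comap_injective Q)

theorem RgMax_quotient_finite_of_finite [Module.Finite R T]
    (hinj : Function.Injective (algebraMap R T)) (hfin : (RgMax T).Finite)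
    (h : ∀ Q : Ideal T, Q.IsPrime → IsAbsolutelyAlgebraic (T ⧸ Q)) (P : Ideal R) (hP : P.IsPrime) :
    (RgMax (R ⧸ P)).Finite := by
  have hPf := (isAbsolutelyAlgebraic_quotient_of_isIntegral hinj h P hP).isField
  obtain ⟨Q, -, hQ, rfl⟩ := Ideal.exists_ideal_over_prime_of_isIntegral (S := T) P ⊥
    (by rw [Ideal.comap_bot_of_injective _ hinj]; exact bot_le)
  let _ : Field (R ⧸ Q.comap (algebraMap R T)) := hPf.toField
  let _ : Field (T ⧸ Q) := (h Q hQ).isField.toField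
  have : Module.Finite (R ⧸ Q.comap (algebraMap R T)) (T ⧸ Q) :=
    Module.Finite.of_restrictScalars_finite R _ _
  exact RgMax_finite_of_finiteDimensional (K := R ⧸ Q.comap (algebraMap R T)) (L := T ⧸ Q) (h Q hQ)
    (RgMax_finite_of_surjective _ Ideal.Quotient.mk_surjective hfin)

theorem semilocalRing_iff_of_finite [Module.Finite R T]
    (hinj : Function.Injective (algebraMap R T)) : SemilocalRing R ↔ SemilocalRing T := by
  constructor
  · intro hR
    -- Maximal ideals of `T` lie over maximal ideals of `R`, and the fibres of a finite extension
    -- are finite.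
    refine Set.Finite.subset (Set.Finite.biUnion hR fun P _ =>
      Algebra.QuasiFinite.finite_primesOver (S := T) P) fun Q hQ => ?_
    have : Q.IsMaximal := hQ
    exact Set.mem_biUnion (x := Q.comap (algebraMap R T))
      (Ideal.isMaximal_comap_of_isIntegral_of_isMaximal Q) ⟨this.isPrime, ⟨rfl⟩⟩
  · intro hT
    refine (hT.image (Ideal.comap (algebraMap R T))).subset fun P hP => ?_
    have : P.IsMaximal := hP
    obtain ⟨Q, hQ, hQP⟩ := Ideal.exists_ideal_over_maximal_of_isIntegral (S := T) P
      (by rw [(RingHom.injective_iff_ker_eq_bot _).1 hinj]; exact bot_le)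
    exact ⟨Q, hQ, hQP⟩

theorem finitelyManyMaximalSubringsUpToIso_quotient_nilradical (hdim : Ring.KrullDimLE 0 R)
    (hR : SemilocalRing R) (hfin : ∀ P : Ideal R, P.IsPrime → (RgMax (R ⧸ P)).Finite) :
    FinitelyManyMaximalSubringsUpToIso (R ⧸ nilradical R) := by
  refine finitelyManyMaximalSubringsUpToIso_of_semilocal
    (hR.of_surjective _ Ideal.Quotient.mk_surjective) (fun a ha => ?_) fun M hM => ?_
  · obtain ⟨r, rfl⟩ := Ideal.Quotient.mk_surjective a
    -- In dimension zero every prime is maximal, so the Jacobson radical of the reduced quotient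
    -- vanishes.
    rw [Ideal.Quotient.eq_zero_iff_mem, nilradical_eq_sInf, Ideal.mem_sInf]
    intro P (hP : P.IsPrime)
    have hPm : P.IsMaximal := Ring.krullDimLE_zero_iff.1 hdim P hP
    have hle : nilradical R ≤ P := nilradical_le_prime P
    have hcomap : (P.map (Ideal.Quotient.mk (nilradical R))).comap (Ideal.Quotient.mk _) = P := by
      rw [Ideal.comap_map_of_surjective _ Ideal.Quotient.mk_surjective, ← RingHom.ker_eq_comap_bot,
        Ideal.mk_ker, sup_eq_left.2 hle]
    rw [← hcomap]
    refine ha _ ((Ideal.map_eq_top_or_isMaximal_of_surjective _ Ideal.Quotient.mk_surjective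
      hPm).resolve_left fun htop => hP.ne_top ?_)
    rw [← hcomap, htop, Ideal.comap_top]
  · have := hM.isPrime
    have hP : (M.comap (Ideal.Quotient.mk (nilradical R))).IsPrime := inferInstance
    refine RgMax_finite_of_surjective (Ideal.quotientMap M (Ideal.Quotient.mk (nilradical R)) le_rfl)
      (Ideal.quotientMap_surjective Ideal.Quotient.mk_surjective) (hfin _ hP)

end

theorem theorem3p7 {R : Type*} {T : Type*} [CommRing R] [CommRing T] [Nontrivial T] [Algebra R T]
    (hRT : Function.Injective (algebraMap R T))
    (n : ℕ) (α : Fin n → T) (hT : Algebra.adjoin R (Set.range α) = ⊤)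
    (hfin : (RgMax T).Finite) :
    (ZeroDimensional R ↔ ZeroDimensional T) ∧
    (SemilocalRing R ↔ SemilocalRing T) ∧
    (IsArtinianRing R ↔ IsArtinianRing T) ∧
    (ZeroDimensional R ∨ ZeroDimensional T ∨ SemilocalRing R ∨ SemilocalRing T ∨
        IsArtinianRing R ∨ IsArtinianRing T →
      Module.Finite R T ∧ ∀ P : Ideal R, P.IsPrime → (RgMax (R ⧸ P)).Finite) ∧
    (SemilocalRing R ∨ SemilocalRing T ∨ IsArtinianRing R ∨ IsArtinianRing T →
      FinitelyManyMaximalSubringsUpToIso (R ⧸ nilradical R)) := by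
  have : Nontrivial R := (algebraMap R T).domain_nontrivial
  have : Algebra.FiniteType R T := ⟨⟨(Set.finite_range α).toFinset, by simpa using hT⟩⟩
  have hRA : IsArtinianRing R → SemilocalRing R := fun _ => IsArtinianRing.setOfPred_isMaximal_finite R
  have hTA : IsArtinianRing T → SemilocalRing T := fun _ => IsArtinianRing.setOfPred_isMaximal_finite T
  have main : ZeroDimensional R ∨ ZeroDimensional T ∨ SemilocalRing R ∨ SemilocalRing T →
      Ring.KrullDimLE 0 R ∧ Ring.KrullDimLE 0 T ∧ Module.Finite R T ∧
        ∀ P : Ideal R, P.IsPrime → (RgMax (R ⧸ P)).Finite := fun h => by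
    have habs := isAbsolutelyAlgebraic_quotient_of_or hRT hfin h
    have : Algebra.IsIntegral R T := isIntegral_of_isAbsolutelyAlgebraic habs
    have hmod : Module.Finite R T := Algebra.IsIntegral.finite
    exact ⟨krullDimLE_zero_of_isAbsolutelyAlgebraic
      (isAbsolutelyAlgebraic_quotient_of_isIntegral hRT habs),
      krullDimLE_zero_of_isAbsolutelyAlgebraic habs, hmod,
      RgMax_quotient_finite_of_finite hRT hfin habs⟩
  have hSL : SemilocalRing R ↔ SemilocalRing T := by
    constructor <;> intro h
    · have := (main (by tauto)).2.2.1
      exact (semilocalRing_iff_of_finite hRT).1 h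
    · have := (main (by tauto)).2.2.1
      exact (semilocalRing_iff_of_finite hRT).2 h
  refine ⟨?_, hSL, ?_, fun h => (main (by tauto)).2.2, fun h => ?_⟩
  · constructor <;> intro h <;> rw [zeroDimensional_iff]
    · exact (main (by tauto)).2.1
    · exact (main (by tauto)).1
  · constructor <;> intro h
    · have := (main (by tauto)).2.2.1
      exact IsArtinianRing.of_finite R T
    · have := (main (by tauto)).2.2.1
      exact isArtinianRing_of_finite_of_injective hRT
  · have hR : SemilocalRing R := by tauto
    obtain ⟨hdim, -, -, hP⟩ := main (by tauto)
    exact finitelyManyMaximalSubringsUpToIso_quotient_nilradical hdim hR hP
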